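/- **Notation.** For a real matrix $A$ let $\|A\|_F,\ \|A\|,\ \|A\|_{\max},\ \|A\|_0$ be its Frobenius norm, spectral norm, largest absolute entry and number of nonzero entries. A matrix $U\in\mathbb R^{p\times r}$ belongs to $\mathcal O^{\mu}_{p,r}$ if $U^\top U=I_r$ and every row of $U$ has Euclidean norm at most $\sqrt{\mu r/p}$. Let $\mathcal L^{\mu}_{p,r}$ be the set of matrices $UDV^\top$ with $U,V\in\mathcal O^{\mu}_{p,r}$ and $D$ diagonal with nonnegative entries. For $\tau>0$ let $\psi_\tau(x)=\operatorname{sign}(x)\min(|x|,\tau)$. **Setting.** Let $n\ge1$, $p\ge2$, and let $X_1,\dots,X_n$ be i.i.d. random vectors in $\mathbb R^p$ with $\mathbb E X_{kj}^4\le C$ for all $k,j$ and covariance matrix $\Sigma=\Sigma_L+\Sigma_S$. The pilot estimator $\widehat\Sigma$ has entries $$\widehat\sigma_{ij}=\frac1n\sum_{k=1}^n\psi_{\tau_1}(X_{ki}X_{kj})-\Big(\frac1n\sum_{k=1}^n\psi_{\tau_2}(X_{ki})\Big)\Big(\frac1n\sum_{k=1}^n\psi_{\tau_2}(X_{kj})\Big),\qquad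 a\sqrt n\le\tau_1,\tau_2\le b\sqrt n,$$ with constants $0<a\le b$. Let $1\le r\le\bar r\le Ar$, $s\le\bar s\le As$ and $\mu\le\bar\mu$ for a constant $A\ge1$, and suppose that $\Sigma_L\in\mathcal L^{\mu}_{p,r}\cap\mathcal L^{\bar\mu}_{p,\bar r}$, $\|\Sigma_S\|_0\le s$ and $\bar s\le \dfrac{p}{8c\,\bar\mu\,\bar r^4}$, where $c>0$ is the absolute constant of the theorem. Let $(\widehat\Sigma_L,\widehat\Sigma_S)$ be any solution of $$\min_{L,S}\ \tfrac12\|\widehat\Sigma-(L+S)\|_F^2\quad\text{subject to}\quad L\in\mathcal L^{\bar\mu}_{p,\bar r},\ \|S\|_0\le\bar s .$$ **Theorem.** There is an absolute constant $c>0$ such that, in this setting: 1. for every realization of the data, $$\|\widehat\Sigma_L-\Sigma_L\|_F^2+\|\widehat\Sigma_S-\Sigma_S\|_F^2\le K\left(r\|\widehat\Sigma-\Sigma\|^2+s\|\widehat\Sigma-\Sigma\|_{\max}^2\right),$$ where $K$ depends only on $A$; 2. $r\|\widehat\Sigma-\Sigma\|^2+s\|\widehat\Sigma-\Sigma\|_{\max}^2=O_p\!\left(\dfrac{rp^2\log^2p}{n}\right)$,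 that is, for every $\varepsilon>0$ there is $M$, depending only on $\varepsilon,A,C,a,b$, such that $$\mathbb P\left(r\|\widehat\Sigma-\Sigma\|^2+s\|\widehat\Sigma-\Sigma\|_{\max}^2>M\,\frac{rp^2\log^2p}{n}\right)\le\varepsilon .$$ -/

import Mathlib

open MeasureTheory ProbabilityTheory

namespace RobustCov

noncomputable section

/-- Frobenius norm. -/
def frobNorm {p q : ℕ} (A : Matrix (Fin p) (Fin q) ℝ) : ℝ :=
  Real.sqrt (∑ i, ∑ j, A i j ^ 2)

/-- Spectral norm: operator norm with respect to the Euclidean norms. -/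
def specNorm {p : ℕ} (A : Matrix (Fin p) (Fin p) ℝ) : ℝ :=
  ‖Matrix.toEuclideanCLM (𝕜 := ℝ) A‖

/-- Largest absolute value of an entry (the norm on a finite product of reals is the
sup norm). -/
def maxNorm {p : ℕ} (A : Matrix (Fin p) (Fin p) ℝ) : ℝ :=
  ‖fun ij : Fin p × Fin p => A ij.1 ij.2‖

/-- Number of nonzero entries. -/
def numNonzero {p : ℕ} (A : Matrix (Fin p) (Fin p) ℝ) : ℕ :=
  Set.ncard {ij : Fin p × Fin p | A ij.1 ij.2 ≠ 0}

/-- `U` has orthonormal columns and is `μ`-incoherent: each of its rows has Euclidean norm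
at most `√(μ r / p)`. -/
def IsIncoherent {p r : ℕ} (μ : ℝ) (U : Matrix (Fin p) (Fin r) ℝ) : Prop :=
  U.transpose * U = 1 ∧ ∀ i, Real.sqrt (∑ k, U i k ^ 2) ≤ Real.sqrt (μ * r / p)

/-- `L = U D Vᵀ` with `U`, `V` of size `p × r`, orthonormal and `μ`-incoherent, and `D` diagonal
with nonnegative entries. Singular values may vanish, so the rank of `L` is at most `r`. -/
def HasIncoherentSVD {p : ℕ} (r : ℕ) (μ : ℝ) (L : Matrix (Fin p) (Fin p) ℝ) : Prop :=
  ∃ (U V : Matrix (Fin p) (Fin r) ℝ) (d : Fin r → ℝ),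
    IsIncoherent μ U ∧ IsIncoherent μ V ∧ (∀ k, 0 ≤ d k) ∧
      L = U * Matrix.diagonal d * V.transpose

/-- The constraint set of the incoherent-constrained least squares. -/
def Feasible {p : ℕ} (r s : ℕ) (μ : ℝ) (L S : Matrix (Fin p) (Fin p) ℝ) : Prop :=
  HasIncoherentSVD r μ L ∧ numNonzero S ≤ s

/-- `(L, S)` solves the incoherent-constrained least squares with observation `Y`. -/
def IsConstrainedLS {p : ℕ} (r s : ℕ) (μ : ℝ) (Y L S : Matrix (Fin p) (Fin p) ℝ) : Prop :=
  Feasible r s μ L S ∧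
    ∀ L' S', Feasible r s μ L' S' →
      1 / 2 * frobNorm (Y - (L + S)) ^ 2 ≤ 1 / 2 * frobNorm (Y - (L' + S')) ^ 2

/-- Winsorization of a real number at level `τ`. -/
def winsorize (τ x : ℝ) : ℝ := Real.sign x * min |x| τ

/-- The entrywise-Winsorized covariance estimator of the sample `x 0, …, x (n-1)` in `ℝ^p`;
products are truncated at `τ₁`, coordinates at `τ₂`. -/
def pilotCov {n p : ℕ} (τ₁ τ₂ : ℝ) (x : Fin n → Fin p → ℝ) : Matrix (Fin p) (Fin p) ℝ :=
  Matrix.of fun i j =>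
    (1 / (n : ℝ)) * ∑ k, winsorize τ₁ (x k i * x k j) -
      ((1 / (n : ℝ)) * ∑ k, winsorize τ₂ (x k i)) * ((1 / (n : ℝ)) * ∑ k, winsorize τ₂ (x k j))

/-- The covariance matrix of a random vector. -/
def covMatrix {Ω : Type*} [MeasurableSpace Ω] {p : ℕ} (P : Measure Ω) (X : Ω → Fin p → ℝ) :
    Matrix (Fin p) (Fin p) ℝ :=
  Matrix.of fun i j => covariance (fun ω => X ω i) (fun ω => X ω j) P

end

end RobustCov

namespace RobustCov

open Matrix

/-! The first part is deterministic. Let `ΔL`, `ΔS` be the two errors and `E` the error of the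
observation. Comparing the minimizer with the feasible true pair gives `‖ΔL + ΔS‖² ≤ 2⟨E, ΔL + ΔS⟩`
in Frobenius norm. Low rank and sparsity separate because incoherence spreads `ΔL` out: it splits as
`U * B + C * Vᵀ` (`exists_incoherent_decomposition`), so its squared entries are at most `4μr/p`
times `‖ΔL‖²`, while `ΔS` has at most `2s` nonzero entries. Hence the cross term `⟨ΔL, ΔS⟩` absorbs
only half of `‖ΔL‖² + ‖ΔS‖²`. The same splitting bounds `⟨E, ΔL⟩` by the spectral norm, and sparsity
bounds `⟨E, ΔS⟩` by the max norm; `IsConstrainedLS.error_le` combines these.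

The second part needs only fourth moments and Markov. Truncation at order `√n` gives every
Winsorized mean an error with fourth moment `O(n⁻²)` (`integral_winsorized_mean_sub_pow_four_le`).
Fourth powers, rather than squares, handle the products of two mean errors, and they allow a maximum
over `p²` entries at the cost of a factor `p` in the square. Since the sparsity condition forces `s
≤ p`, both terms are of order `r p²/n`; the factor `log² p` is not needed for the rate. -/

/-- Squared Frobenius norm. -/
def frobSq {m n : ℕ} (A : Matrix (Fin m) (Fin n) ℝ) : ℝ := ∑ i, ∑ j, A i j ^ 2

/-- Frobenius inner product. -/
def frobInner {m n : ℕ} (A B : Matrix (Fin m) (Fin n) ℝ) : ℝ := ∑ i, ∑ j, A i j * B i j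

/-! ### Frobenius geometry and orthogonal projections. -/

section Frobenius

variable {m n r : ℕ}

lemma frobSq_nonneg (A : Matrix (Fin m) (Fin n) ℝ) : 0 ≤ frobSq A := by
  unfold frobSq; positivity

lemma frobNorm_nonneg (A : Matrix (Fin m) (Fin n) ℝ) : 0 ≤ frobNorm A := Real.sqrt_nonneg _

lemma frobNorm_sq (A : Matrix (Fin m) (Fin n) ℝ) : frobNorm A ^ 2 = frobSq A :=
  Real.sq_sqrt (frobSq_nonneg A)

lemma frobSq_eq_trace (A : Matrix (Fin m) (Fin n) ℝ) : frobSq A = (Aᵀ * A).trace := by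
  simp only [frobSq, Matrix.trace, Matrix.diag, Matrix.mul_apply, Matrix.transpose_apply]
  rw [Finset.sum_comm]
  simp [sq]

lemma frobInner_eq_trace (A B : Matrix (Fin m) (Fin n) ℝ) : frobInner A B = (Aᵀ * B).trace := by
  simp only [frobInner, Matrix.trace, Matrix.diag, Matrix.mul_apply, Matrix.transpose_apply]
  rw [Finset.sum_comm]

lemma frobSq_transpose (A : Matrix (Fin m) (Fin n) ℝ) : frobSq Aᵀ = frobSq A := by
  simp only [frobSq, Matrix.transpose_apply]
  rw [Finset.sum_comm]

lemma frobInner_add_right (A B C : Matrix (Fin m) (Fin n) ℝ) :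
    frobInner A (B + C) = frobInner A B + frobInner A C := by
  simp [frobInner, mul_add, Finset.sum_add_distrib]

lemma frobSq_add (A B : Matrix (Fin m) (Fin n) ℝ) :
    frobSq (A + B) = frobSq A + 2 * frobInner A B + frobSq B := by
  simp only [frobSq, frobInner, Matrix.add_apply, Finset.mul_sum, ← Finset.sum_add_distrib]
  exact Finset.sum_congr rfl fun i _ => Finset.sum_congr rfl fun j _ => by ring

lemma frobSq_sub (A B : Matrix (Fin m) (Fin n) ℝ) :
    frobSq (A - B) = frobSq A - 2 * frobInner A B + frobSq B := by
  simp only [frobSq, frobInner, Matrix.sub_apply, Finset.mul_sum, ← Finset.sum_add_distrib,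
    ← Finset.sum_sub_distrib]
  exact Finset.sum_congr rfl fun i _ => Finset.sum_congr rfl fun j _ => by ring

lemma frobInner_sq_le (A B : Matrix (Fin m) (Fin n) ℝ) :
    frobInner A B ^ 2 ≤ frobSq A * frobSq B := by
  simp only [frobInner, frobSq, ← Fintype.sum_prod_type']
  exact Finset.sum_mul_sq_le_sq_mul_sq _ _ _

/-- A row of `A * B` is controlled by the row of `A` and the Frobenius norm of `B`. -/
lemma mul_apply_sq_le (A : Matrix (Fin m) (Fin r) ℝ) (B : Matrix (Fin r) (Fin n) ℝ)
    (i : Fin m) (j : Fin n) : (A * B) i j ^ 2 ≤ (∑ k, A i k ^ 2) * frobSq B := by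
  rw [Matrix.mul_apply]
  refine (Finset.sum_mul_sq_le_sq_mul_sq _ _ _).trans ?_
  refine mul_le_mul_of_nonneg_left ?_ (by positivity)
  exact Finset.sum_le_sum fun k _ =>
    Finset.single_le_sum (f := fun l => B k l ^ 2) (fun _ _ => sq_nonneg _) (Finset.mem_univ j)

/-- Pythagoras for the projection onto the column space of an orthonormal `U`. -/
lemma frobSq_eq_add_of_orthonormal {U : Matrix (Fin m) (Fin r) ℝ} (hU : Uᵀ * U = 1)
    (M : Matrix (Fin m) (Fin n) ℝ) :
    frobSq M = frobSq (Uᵀ * M) + frobSq (M - U * (Uᵀ * M)) := by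
  have h1 : frobInner M (U * (Uᵀ * M)) = frobSq (Uᵀ * M) := by
    rw [frobInner_eq_trace, frobSq_eq_trace, Matrix.transpose_mul, Matrix.transpose_transpose,
      Matrix.mul_assoc]
  have h2 : frobSq (U * (Uᵀ * M)) = frobSq (Uᵀ * M) := by
    rw [frobSq_eq_trace, frobSq_eq_trace, Matrix.transpose_mul U, Matrix.mul_assoc,
      ← Matrix.mul_assoc Uᵀ U, hU, Matrix.one_mul]
  rw [frobSq_sub, h1, h2]
  ring

lemma frobSq_transpose_mul_le {U : Matrix (Fin m) (Fin r) ℝ} (hU : Uᵀ * U = 1)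
    (M : Matrix (Fin m) (Fin n) ℝ) : frobSq (Uᵀ * M) ≤ frobSq M := by
  rw [frobSq_eq_add_of_orthonormal hU M]
  linarith [frobSq_nonneg (M - U * (Uᵀ * M))]

lemma frobSq_mul_le {V : Matrix (Fin n) (Fin r) ℝ} (hV : Vᵀ * V = 1)
    (M : Matrix (Fin m) (Fin n) ℝ) : frobSq (M * V) ≤ frobSq M := by
  rw [← frobSq_transpose, Matrix.transpose_mul, ← frobSq_transpose M]
  exact frobSq_transpose_mul_le hV _

end Frobenius

/-! ### Spectral and max norms, and sparse matrices. -/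

section Norms

variable {p r : ℕ}

lemma abs_apply_le_maxNorm (A : Matrix (Fin p) (Fin p) ℝ) (i j : Fin p) :
    |A i j| ≤ maxNorm A :=
  norm_le_pi_norm (fun ij : Fin p × Fin p => A ij.1 ij.2) (i, j)

lemma maxNorm_nonneg (A : Matrix (Fin p) (Fin p) ℝ) : 0 ≤ maxNorm A := norm_nonneg _

lemma maxNorm_le {A : Matrix (Fin p) (Fin p) ℝ} {t : ℝ} (ht : 0 ≤ t)
    (h : ∀ i j, |A i j| ≤ t) : maxNorm A ≤ t :=
  (pi_norm_le_iff_of_nonneg ht).2 fun ij => h ij.1 ij.2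

lemma specNorm_transpose (A : Matrix (Fin p) (Fin p) ℝ) : specNorm Aᵀ = specNorm A := by
  unfold specNorm
  have : Aᵀ = star A := by
    rw [Matrix.star_eq_conjTranspose, Matrix.conjTranspose_eq_transpose_of_trivial]
  rw [this, map_star, ContinuousLinearMap.star_eq_adjoint, LinearIsometryEquiv.norm_map]

lemma sum_mulVec_sq_le (A : Matrix (Fin p) (Fin p) ℝ) (v : Fin p → ℝ) :
    ∑ i, (A *ᵥ v) i ^ 2 ≤ specNorm A ^ 2 * ∑ i, v i ^ 2 := by
  have h := (Matrix.toEuclideanCLM (𝕜 := ℝ) A).le_opNorm (WithLp.toLp 2 v)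
  have h2 := pow_le_pow_left₀ (norm_nonneg _) h 2
  rw [mul_pow, EuclideanSpace.norm_sq_eq, EuclideanSpace.norm_sq_eq] at h2
  simpa [specNorm] using h2

/-- This crude comparison is enough for the stochastic part, since the target rate is already `r`
times the squared Frobenius error of the pilot estimator. -/
lemma specNorm_sq_le (A : Matrix (Fin p) (Fin p) ℝ) : specNorm A ^ 2 ≤ frobSq A := by
  have h : specNorm A ≤ frobNorm A := by
    refine ContinuousLinearMap.opNorm_le_bound _ (frobNorm_nonneg A) fun x => ?_
    refine le_of_sq_le_sq ?_ (by have := frobNorm_nonneg A; positivity)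
    rw [mul_pow, EuclideanSpace.norm_sq_eq, EuclideanSpace.norm_sq_eq, frobNorm_sq, frobSq,
      Finset.sum_mul]
    refine Finset.sum_le_sum fun i _ => ?_
    simpa [Matrix.mulVec, dotProduct] using
      Finset.sum_mul_sq_le_sq_mul_sq Finset.univ (A i) (fun j => x j)
  rw [← frobNorm_sq]
  exact pow_le_pow_left₀ (norm_nonneg _) h 2

/-- The `r` columns of `V` are unit vectors, and each contributes at most `specNorm A ^ 2`. This is
where rank meets the spectral norm. -/
lemma frobSq_mul_orthonormal_le {V : Matrix (Fin p) (Fin r) ℝ} (hV : Vᵀ * V = 1)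
    (A : Matrix (Fin p) (Fin p) ℝ) : frobSq (A * V) ≤ r * specNorm A ^ 2 := by
  have hcol : ∀ k, ∑ i, V i k ^ 2 = 1 := fun k => by
    have := congrFun (congrFun hV k) k
    simpa [Matrix.mul_apply, sq] using this
  rw [← frobSq_transpose]
  calc frobSq (A * V)ᵀ = ∑ k, ∑ i, (A *ᵥ fun l => V l k) i ^ 2 := rfl
    _ ≤ ∑ _k : Fin r, specNorm A ^ 2 := Finset.sum_le_sum fun k _ => by
        simpa [hcol k] using sum_mulVec_sq_le A fun l => V l k
    _ = r * specNorm A ^ 2 := by simp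

lemma frobSq_transpose_mul_orthonormal_le {U : Matrix (Fin p) (Fin r) ℝ} (hU : Uᵀ * U = 1)
    (A : Matrix (Fin p) (Fin p) ℝ) : frobSq (Uᵀ * A) ≤ r * specNorm A ^ 2 := by
  rw [← frobSq_transpose, Matrix.transpose_mul, Matrix.transpose_transpose, ← specNorm_transpose]
  exact frobSq_mul_orthonormal_le hU _

lemma numNonzero_sub_le (A B : Matrix (Fin p) (Fin p) ℝ) :
    numNonzero (A - B) ≤ numNonzero A + numNonzero B := by
  unfold numNonzero
  refine (Set.ncard_le_ncard (fun ij h => ?_) (Set.toFinite _)).trans (Set.ncard_union_le _ _)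
  by_contra hc
  simp only [Set.mem_union, Set.mem_ofPred_eq, not_or, not_not] at hc
  exact h (by simp [hc.1, hc.2])

/-- Hölder-type bound for a matrix with bounded entries against a sparse one. -/
lemma frobInner_sq_le_of_sparse {N M : Matrix (Fin p) (Fin p) ℝ} {t : ℝ}
    (hN : ∀ i j, N i j ^ 2 ≤ t) : frobInner N M ^ 2 ≤ t * numNonzero M * frobSq M := by
  classical
  simp only [frobInner, frobSq, ← Fintype.sum_prod_type']
  set T : Finset (Fin p × Fin p) := Finset.univ.filter fun ij => M ij.1 ij.2 ≠ 0 with hT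
  have hcard : numNonzero M = T.card := by
    rw [numNonzero, ← Set.ncard_coe_finset]
    simp [hT]
  have hsum : ∑ x : Fin p × Fin p, N x.1 x.2 * M x.1 x.2 = ∑ x ∈ T, N x.1 x.2 * M x.1 x.2 := by
    refine (Finset.sum_subset (Finset.subset_univ _) fun x _ hx => ?_).symm
    have : M x.1 x.2 = 0 := by simpa [hT] using hx
    simp [this]
  have hNT : ∑ x ∈ T, N x.1 x.2 ^ 2 ≤ t * T.card := by
    refine (Finset.sum_le_card_nsmul T _ t fun x _ => hN _ _).trans_eq ?_
    rw [nsmul_eq_mul, mul_comm]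
  rw [hsum, hcard]
  refine (Finset.sum_mul_sq_le_sq_mul_sq _ _ _).trans ?_
  refine mul_le_mul hNT ?_ (by positivity) ((by positivity : (0 : ℝ) ≤ _).trans hNT)
  exact Finset.sum_le_sum_of_subset_of_nonneg (Finset.subset_univ _) fun _ _ _ => sq_nonneg _

end Norms

/-! ### Incoherence and the deterministic error bound. -/

section Deterministic

variable {p r : ℕ} {μ : ℝ}

/-- The squared entries of `U` sum to `r`, yet each of the `p` rows carries at most `μ r / p`. The
maximum with `0` covers a negative `μ`, for which `Real.sqrt` returns `0`. -/
lemma IsIncoherent.one_le {U : Matrix (Fin p) (Fin r) ℝ} (hU : IsIncoherent μ U) (hr : 1 ≤ r)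
    (hp : 1 ≤ p) : 1 ≤ μ := by
  have hr' : (1 : ℝ) ≤ r := by exact_mod_cast hr
  have hp' : (1 : ℝ) ≤ p := by exact_mod_cast hp
  have htr : frobSq U = r := by rw [frobSq_eq_trace, hU.1]; simp
  have hle : ∀ i, ∑ k, U i k ^ 2 ≤ max (μ * r / p) 0 := fun i => by
    have h := pow_le_pow_left₀ (Real.sqrt_nonneg _) (hU.2 i) 2
    rw [Real.sq_sqrt (by positivity)] at h
    rcases le_total 0 (μ * r / p) with h0 | h0
    · rw [Real.sq_sqrt h0] at h; exact h.trans (le_max_left _ _)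
    · rw [Real.sqrt_eq_zero_of_nonpos h0] at h; exact (h.trans_eq (by simp)).trans (le_max_right _ _)
  have h : (r : ℝ) ≤ p * max (μ * r / p) 0 := by
    refine htr.ge.trans ((Finset.sum_le_sum fun i _ => hle i).trans_eq ?_)
    simp
  rcases le_total 0 (μ * r / p) with h0 | h0
  · rw [max_eq_left h0, mul_div_cancel₀ _ (by positivity)] at h
    nlinarith
  · rw [max_eq_right h0] at h; linarith

lemma IsIncoherent.row_sq_le {U : Matrix (Fin p) (Fin r) ℝ} (hU : IsIncoherent μ U)
    (hμ : 0 ≤ μ) (i : Fin p) : ∑ k, U i k ^ 2 ≤ μ * r / p := by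
  have h := pow_le_pow_left₀ (Real.sqrt_nonneg _) (hU.2 i) 2
  rwa [Real.sq_sqrt (by positivity), Real.sq_sqrt (by positivity)] at h

/-- The difference of two matrices with incoherent singular vectors splits into a matrix with
incoherent columns and one with incoherent rows. -/
lemma exists_incoherent_decomposition {L L' : Matrix (Fin p) (Fin p) ℝ}
    (hL : HasIncoherentSVD r μ L) (hL' : HasIncoherentSVD r μ L') :
    ∃ (U V : Matrix (Fin p) (Fin r) ℝ) (B : Matrix (Fin r) (Fin p) ℝ)
      (C : Matrix (Fin p) (Fin r) ℝ), IsIncoherent μ U ∧ IsIncoherent μ V ∧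
      frobSq B ≤ frobSq (L' - L) ∧ frobSq C ≤ frobSq (L' - L) ∧ L' - L = U * B + C * Vᵀ := by
  obtain ⟨U, V₀, d, hU, -, -, rfl⟩ := hL
  obtain ⟨U₀, V, d', -, hV, -, rfl⟩ := hL'
  set Δ := U₀ * diagonal d' * Vᵀ - U * diagonal d * V₀ᵀ with hΔ
  -- `U` comes from `L` and `V` from `L'`. Projecting off the columns of `U` kills `L`; what remains
  -- of `L'` has its rows in the span of the columns of `V`, so multiplying by `V * Vᵀ` changes
  -- nothing.
  refine ⟨U, V, Uᵀ * Δ, (Δ - U * (Uᵀ * Δ)) * V, hU, hV, frobSq_transpose_mul_le hU.1 _, ?_, ?_⟩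
  · refine (frobSq_mul_le hV.1 _).trans ?_
    rw [frobSq_eq_add_of_orthonormal hU.1 Δ]
    linarith [frobSq_nonneg (Uᵀ * Δ)]
  · have h1 : Uᵀ * (U * diagonal d * V₀ᵀ) = diagonal d * V₀ᵀ := by
      rw [Matrix.mul_assoc U, ← Matrix.mul_assoc, hU.1, Matrix.one_mul]
    have h2 : U₀ * diagonal d' * Vᵀ * V * Vᵀ = U₀ * diagonal d' * Vᵀ := by
      rw [Matrix.mul_assoc _ Vᵀ V, hV.1, Matrix.mul_one]
    have h3 : Δ - U * (Uᵀ * Δ)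
        = U₀ * diagonal d' * Vᵀ - U * (Uᵀ * (U₀ * diagonal d' * Vᵀ)) := by
      rw [hΔ, Matrix.mul_sub, h1, Matrix.mul_sub, ← Matrix.mul_assoc U (diagonal d)]
      abel
    have h4 : (Δ - U * (Uᵀ * Δ)) * V * Vᵀ = Δ - U * (Uᵀ * Δ) := by
      rw [h3, Matrix.sub_mul, Matrix.sub_mul, h2, Matrix.mul_assoc U _ V, Matrix.mul_assoc U _ Vᵀ,
        Matrix.mul_assoc Uᵀ _ V, Matrix.mul_assoc Uᵀ _ Vᵀ, h2]
    rw [h4]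
    abel

/-- The difference of two incoherent low-rank matrices has no large entries. -/
lemma sub_apply_sq_le {L L' : Matrix (Fin p) (Fin p) ℝ} (hμ : 0 ≤ μ)
    (hL : HasIncoherentSVD r μ L) (hL' : HasIncoherentSVD r μ L') (i j : Fin p) :
    (L' - L) i j ^ 2 ≤ 4 * (μ * r / p) * frobSq (L' - L) := by
  obtain ⟨U, V, B, C, hU, hV, hB, hC, h⟩ := exists_incoherent_decomposition hL hL'
  have hκ : 0 ≤ μ * r / p := by positivity
  have h1 : (U * B) i j ^ 2 ≤ μ * r / p * frobSq (L' - L) :=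
    (mul_apply_sq_le U B i j).trans
      (mul_le_mul (hU.row_sq_le hμ i) hB (frobSq_nonneg _) hκ)
  have h2 : (C * Vᵀ) i j ^ 2 ≤ μ * r / p * frobSq (L' - L) := by
    have := mul_apply_sq_le V Cᵀ j i
    rw [← Matrix.transpose_transpose V, ← Matrix.transpose_mul, Matrix.transpose_transpose,
      frobSq_transpose] at this
    exact this.trans (mul_le_mul (hV.row_sq_le hμ j) hC (frobSq_nonneg _) hκ)
  have h3 : (L' - L) i j = (U * B) i j + (C * Vᵀ) i j := by rw [h]; rfl
  rw [h3]
  nlinarith [sq_nonneg ((U * B) i j - (C * Vᵀ) i j)]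

/-- Trace duality for the difference of two low-rank matrices. -/
lemma frobInner_sub_sq_le {L L' : Matrix (Fin p) (Fin p) ℝ}
    (hL : HasIncoherentSVD r μ L) (hL' : HasIncoherentSVD r μ L')
    (E : Matrix (Fin p) (Fin p) ℝ) :
    frobInner E (L' - L) ^ 2 ≤ 4 * (r * specNorm E ^ 2) * frobSq (L' - L) := by
  obtain ⟨U, V, B, C, hU, hV, hB, hC, h⟩ := exists_incoherent_decomposition hL hL'
  have hκ : 0 ≤ r * specNorm E ^ 2 := by positivity
  have h1 : frobInner E (U * B) ^ 2 ≤ r * specNorm E ^ 2 * frobSq (L' - L) := by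
    have : frobInner E (U * B) = frobInner (Uᵀ * E) B := by
      rw [frobInner_eq_trace, frobInner_eq_trace, Matrix.transpose_mul, Matrix.transpose_transpose,
        Matrix.mul_assoc]
    rw [this]
    exact (frobInner_sq_le _ _).trans
      (mul_le_mul (frobSq_transpose_mul_orthonormal_le hU.1 E) hB (frobSq_nonneg _) hκ)
  have h2 : frobInner E (C * Vᵀ) ^ 2 ≤ r * specNorm E ^ 2 * frobSq (L' - L) := by
    have : frobInner E (C * Vᵀ) = frobInner (E * V) C := by
      rw [frobInner_eq_trace, frobInner_eq_trace, Matrix.transpose_mul, ← Matrix.mul_assoc,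
        Matrix.trace_mul_comm, Matrix.mul_assoc]
    rw [this]
    exact (frobInner_sq_le _ _).trans
      (mul_le_mul (frobSq_mul_orthonormal_le hV.1 E) hC (frobSq_nonneg _) hκ)
  have h3 : frobInner E (L' - L) = frobInner E (U * B) + frobInner E (C * Vᵀ) := by
    rw [← frobInner_add_right, ← h]
  rw [h3]
  nlinarith [sq_nonneg (frobInner E (U * B) - frobInner E (C * Vᵀ))]

/-- Error bound of the constrained least squares in terms of the error of the observation. -/
theorem IsConstrainedLS.error_le {s : ℕ} {Y L S L₀ S₀ : Matrix (Fin p) (Fin p) ℝ}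
    (h : IsConstrainedLS r s μ Y L S) (h₀ : Feasible r s μ L₀ S₀) (hμ : 0 ≤ μ)
    (hs : 32 * (μ * r / p) * s ≤ 1) :
    frobSq (L - L₀) + frobSq (S - S₀) ≤
      64 * (r * specNorm (Y - (L₀ + S₀)) ^ 2 + s * maxNorm (Y - (L₀ + S₀)) ^ 2) := by
  set E := Y - (L₀ + S₀) with hE
  set ΔL := L - L₀ with hΔL
  set ΔS := S - S₀ with hΔS
  have hbasic : frobSq (ΔL + ΔS) ≤ 2 * (frobInner E ΔL + frobInner E ΔS) := by
    have h1 := h.2 L₀ S₀ h₀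
    have h2 : Y - (L + S) = E - (ΔL + ΔS) := by rw [hE, hΔL, hΔS]; abel
    rw [h2, ← hE, frobNorm_sq, frobNorm_sq, frobSq_sub, frobInner_add_right] at h1
    linarith
  have hsupp : (numNonzero ΔS : ℝ) ≤ 2 * s := by
    have := (numNonzero_sub_le S S₀).trans (add_le_add h.1.2 h₀.2)
    have : (numNonzero ΔS : ℝ) ≤ (s + s : ℕ) := by exact_mod_cast this
    push_cast at this
    linarith
  have hl := frobSq_nonneg ΔL
  have ht := frobSq_nonneg ΔS
  -- The entry bound `4μr/p` times the support size `2s` is `8μrs/p`, at most `1/4` by `hs`.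
  have hcross : frobInner ΔL ΔS ^ 2 ≤ 1 / 4 * (frobSq ΔL * frobSq ΔS) := by
    refine (frobInner_sq_le_of_sparse (sub_apply_sq_le hμ h₀.1 h.1.1)).trans ?_
    have h1 : 4 * (μ * r / p) * frobSq ΔL * numNonzero ΔS * frobSq ΔS
        ≤ 4 * (μ * r / p) * frobSq ΔL * (2 * s) * frobSq ΔS := by gcongr
    refine h1.trans ?_
    nlinarith [mul_le_mul_of_nonneg_right hs (mul_nonneg hl ht)]
  have hEL : frobInner E ΔL ^ 2 ≤ 4 * (r * specNorm E ^ 2) * frobSq ΔL :=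
    frobInner_sub_sq_le h₀.1 h.1.1 E
  have hES : frobInner E ΔS ^ 2 ≤ 2 * (s * maxNorm E ^ 2) * frobSq ΔS := by
    refine (frobInner_sq_le_of_sparse (t := maxNorm E ^ 2) fun i j => ?_).trans ?_
    · rw [← sq_abs]
      exact pow_le_pow_left₀ (abs_nonneg _) (abs_apply_le_maxNorm E i j) 2
    · have : maxNorm E ^ 2 * numNonzero ΔS * frobSq ΔS ≤ maxNorm E ^ 2 * (2 * s) * frobSq ΔS := by
        gcongr
      linarith
  have hsR : 0 ≤ r * specNorm E ^ 2 := by positivity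
  have hsS : 0 ≤ s * maxNorm E ^ 2 := by positivity
  rw [frobSq_add] at hbasic
  generalize r * specNorm E ^ 2 = α at *
  generalize s * maxNorm E ^ 2 = β at *
  generalize frobInner E ΔL = x at *
  generalize frobInner E ΔS = y at *
  generalize frobInner ΔL ΔS = z at *
  generalize frobSq ΔL = l at *
  generalize frobSq ΔS = t at *
  -- The weights make the absorption close: `(l + t)/2` survives on the left, the noise costs `(l +
  -- t)/4 + 16(α + β)`, and this yields the constant `64`.
  have hz : -(2 * z) ≤ (l + t) / 2 := by
    refine le_trans (neg_le_abs _) (abs_le_of_sq_le_sq ?_ (by positivity))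
    nlinarith [sq_nonneg (l - t)]
  have hx : x ≤ l / 8 + 8 * α := by
    refine le_trans (le_abs_self _) (abs_le_of_sq_le_sq ?_ (by positivity))
    nlinarith [sq_nonneg (l / 8 - 8 * α)]
  have hy : y ≤ t / 8 + 8 * β := by
    refine le_trans (le_abs_self _) (abs_le_of_sq_le_sq ?_ (by positivity))
    nlinarith [sq_nonneg (t / 8 - 8 * β), mul_nonneg hsS ht]
  linarith

end Deterministic

/-! ### Elementary properties of truncation. -/

section Winsorize

lemma winsorize_eq_max_min {τ : ℝ} (hτ : 0 ≤ τ) (x : ℝ) :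
    winsorize τ x = max (-τ) (min x τ) := by
  unfold winsorize
  rcases lt_trichotomy x 0 with hx | rfl | hx
  · rw [Real.sign_of_neg hx, abs_of_neg hx, min_eq_left (by linarith : x ≤ τ), neg_one_mul,
      ← max_neg_neg, neg_neg, max_comm]
  · simp [hτ]
  · rw [Real.sign_of_pos hx, abs_of_pos hx, one_mul, max_eq_right]
    exact (neg_nonpos.2 hτ).trans (le_min hx.le hτ)

lemma abs_winsorize_le {τ : ℝ} (hτ : 0 ≤ τ) (x : ℝ) : |winsorize τ x| ≤ τ := by
  rw [winsorize_eq_max_min hτ, abs_le]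
  exact ⟨le_max_left _ _, max_le (by linarith) (min_le_right _ _)⟩

lemma winsorize_sq_le {τ : ℝ} (hτ : 0 ≤ τ) (x : ℝ) : winsorize τ x ^ 2 ≤ x ^ 2 := by
  rw [sq_le_sq, winsorize_eq_max_min hτ]
  rcases le_total 0 x with hx | hx
  · rw [abs_of_nonneg hx, abs_le]
    exact ⟨(by linarith [le_min hx hτ] : -x ≤ min x τ).trans (le_max_right _ _),
      max_le (by linarith) (min_le_left _ _)⟩
  · rw [abs_of_nonpos hx, min_eq_left (hx.trans hτ), abs_le]
    exact ⟨by rw [neg_neg]; exact le_max_right _ _, max_le (by linarith) (by linarith)⟩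

/-- Where truncation acts, the excess is at most `|x|`, and `|x| ≤ x² / τ` because `|x| ≥ τ`. It
bounds the bias by a second moment. -/
lemma abs_winsorize_sub_le {τ : ℝ} (hτ : 0 < τ) (x : ℝ) : |winsorize τ x - x| ≤ x ^ 2 / τ := by
  rw [winsorize_eq_max_min hτ.le, le_div_iff₀ hτ]
  rcases le_total x (-τ) with h | h
  · rw [max_eq_left ((min_le_left _ _).trans h), abs_of_nonneg (by linarith)]
    nlinarith
  rcases le_total x τ with h' | h'
  · rw [min_eq_left h', max_eq_right h, sub_self, abs_zero, zero_mul]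
    positivity
  · rw [min_eq_right h', max_eq_right (by linarith), abs_of_nonpos (by linarith)]
    nlinarith

lemma measurable_winsorize {τ : ℝ} (hτ : 0 ≤ τ) : Measurable (winsorize τ) := by
  have : winsorize τ = fun x => max (-τ) (min x τ) := funext (winsorize_eq_max_min hτ)
  rw [this]
  fun_prop

end Winsorize

/-! ### Fourth moments of Winsorized means. -/

section Moments

variable {Ω : Type*} [MeasurableSpace Ω] {P : Measure Ω} [IsProbabilityMeasure P]

lemma integrable_of_abs_le {f : Ω → ℝ} {B : ℝ} (hf : AEMeasurable f P) (h : ∀ ω, |f ω| ≤ B) :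
    Integrable f P :=
  Integrable.of_bound hf.aestronglyMeasurable B (Filter.Eventually.of_forall h)

lemma integrable_pow_mul_pow {f g : Ω → ℝ} {A B : ℝ} (hf : AEMeasurable f P)
    (hg : AEMeasurable g P) (hfA : ∀ ω, |f ω| ≤ A) (hgB : ∀ ω, |g ω| ≤ B) (k l : ℕ) :
    Integrable (fun ω => f ω ^ k * g ω ^ l) P := by
  refine integrable_of_abs_le (B := A ^ k * B ^ l) (by fun_prop) fun ω => ?_
  rw [abs_mul, abs_pow, abs_pow]
  have := (abs_nonneg _).trans (hfA ω)
  gcongr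
  exacts [hfA ω, hgB ω]

/-- Second and fourth moments of a sum of independent bounded centered variables. -/
theorem integral_sum_pow_le {ι : Type*} {Y : ι → Ω → ℝ} {B v q : ℝ} (hY : iIndepFun Y P)
    (hm : ∀ k, AEMeasurable (Y k) P) (hB : ∀ k ω, |Y k ω| ≤ B) (h1 : ∀ k, ∫ ω, Y k ω ∂P = 0)
    (h2 : ∀ k, ∫ ω, Y k ω ^ 2 ∂P ≤ v) (h4 : ∀ k, ∫ ω, Y k ω ^ 4 ∂P ≤ q) (s : Finset ι) :
    ∫ ω, (∑ k ∈ s, Y k ω) ^ 2 ∂P ≤ s.card * v ∧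
      ∫ ω, (∑ k ∈ s, Y k ω) ^ 4 ∂P ≤ s.card * q + 3 * s.card ^ 2 * v ^ 2 := by
  classical
  induction s using Finset.induction_on with
  | empty => simp
  | insert a s ha ih =>
    obtain ⟨ih2, ih4⟩ := ih
    set S : Ω → ℝ := fun ω => ∑ k ∈ s, Y k ω with hS
    have hSm : AEMeasurable S P := Finset.aemeasurable_fun_sum s fun k _ => hm k
    have hSB : ∀ ω, |S ω| ≤ s.card * B := fun ω =>
      (Finset.abs_sum_le_sum_abs _ _).trans
        ((Finset.sum_le_card_nsmul s _ B fun k _ => hB k ω).trans_eq (nsmul_eq_mul _ _))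
    have hind : IndepFun (Y a) S P := by
      have := (hY.indepFun_finsetSum_of_notMem₀ hm ha).symm
      rwa [show (∑ k ∈ s, Y k) = S from by ext ω; simp [hS]] at this
    have hS1 : ∫ ω, S ω ∂P = 0 := by
      rw [hS, integral_finsetSum _ fun k _ => integrable_of_abs_le (hm k) (hB k)]
      simp [h1]
    have hint := integrable_pow_mul_pow (hm a) hSm (hB a) hSB
    have hprod : ∀ k l : ℕ, ∫ ω, Y a ω ^ k * S ω ^ l ∂P
        = (∫ ω, Y a ω ^ k ∂P) * ∫ ω, S ω ^ l ∂P := fun k l =>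
      (hind.comp (φ := fun x => x ^ k) (ψ := fun x => x ^ l) (by fun_prop)
        (by fun_prop)).integral_fun_mul_eq_mul_integral
          ((hm a).pow_const k).aestronglyMeasurable (hSm.pow_const l).aestronglyMeasurable
    have hv : 0 ≤ v := (integral_nonneg fun ω => sq_nonneg _).trans (h2 a)
    have hcard : ((insert a s).card : ℝ) = s.card + 1 := by
      rw [Finset.card_insert_of_notMem ha]; push_cast; ring
    rw [hcard]
    simp only [Finset.sum_insert ha]
    constructor
    · have e : ∀ ω, (Y a ω + S ω) ^ 2
          -- Zero powers are kept so that `hint` and `hprod` apply uniformly to every monomial.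
          = Y a ω ^ 2 * S ω ^ 0 + 2 * (Y a ω ^ 1 * S ω ^ 1) + Y a ω ^ 0 * S ω ^ 2 :=
        fun ω => by ring
      change ∫ ω, (Y a ω + S ω) ^ 2 ∂P ≤ _
      simp only [e]
      rw [integral_add ((hint 2 0).fun_add ((hint 1 1).const_mul 2)) (hint 0 2),
        integral_add (hint 2 0) ((hint 1 1).const_mul 2), integral_const_mul, hprod, hprod, hprod]
      simp only [pow_zero, pow_one, h1, integral_const, probReal_univ, smul_eq_mul]
      linarith [h2 a]
    · have e : ∀ ω, (Y a ω + S ω) ^ 4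
          = Y a ω ^ 4 * S ω ^ 0 + 4 * (Y a ω ^ 3 * S ω ^ 1) + 6 * (Y a ω ^ 2 * S ω ^ 2)
            + 4 * (Y a ω ^ 1 * S ω ^ 3) + Y a ω ^ 0 * S ω ^ 4 :=
        fun ω => by ring
      change ∫ ω, (Y a ω + S ω) ^ 4 ∂P ≤ _
      simp only [e]
      rw [integral_add ((((hint 4 0).fun_add ((hint 3 1).const_mul 4)).fun_add
          ((hint 2 2).const_mul 6)).fun_add ((hint 1 3).const_mul 4)) (hint 0 4),
        integral_add (((hint 4 0).fun_add ((hint 3 1).const_mul 4)).fun_add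
          ((hint 2 2).const_mul 6)) ((hint 1 3).const_mul 4),
        integral_add ((hint 4 0).fun_add ((hint 3 1).const_mul 4)) ((hint 2 2).const_mul 6),
        integral_add (hint 4 0) ((hint 3 1).const_mul 4), integral_const_mul, integral_const_mul,
        integral_const_mul, hprod, hprod, hprod, hprod, hprod]
      simp only [pow_zero, pow_one, h1, hS1, integral_const, probReal_univ, smul_eq_mul]
      -- The terms with a first power of `Y a` or of `S` vanish. The middle one gives `6kv²` with `k
      -- = s.card`, and `3k² + 6k ≤ 3(k + 1)²` closes the induction.
      have h22 : (∫ ω, Y a ω ^ 2 ∂P) * ∫ ω, S ω ^ 2 ∂P ≤ v * (s.card * v) :=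
        mul_le_mul (h2 a) ih2 (integral_nonneg fun ω => sq_nonneg _) hv
      have := h4 a
      nlinarith [sq_nonneg v]

lemma sq_integral_le_integral_sq {f : Ω → ℝ} (hf : MemLp f 2 P) :
    (∫ ω, f ω ∂P) ^ 2 ≤ ∫ ω, f ω ^ 2 ∂P := by
  have h := variance_nonneg f P
  rw [variance_eq_sub hf] at h
  simpa using h

/-- Fourth moment of the error of a Winsorized mean with truncation level of order `√n`. -/
theorem integral_winsorized_mean_sub_pow_four_le {n : ℕ} (hn : 1 ≤ n) {a b τ v m : ℝ}
    (ha : 0 < a) (hτa : a * Real.sqrt n ≤ τ) (hτb : τ ≤ b * Real.sqrt n)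
    {Y : Fin n → Ω → ℝ} (hY : iIndepFun Y P) (hm : ∀ k, AEMeasurable (Y k) P)
    (h1 : ∀ k, ∫ ω, Y k ω ∂P = m) (hi2 : ∀ k, Integrable (fun ω => Y k ω ^ 2) P)
    (h2 : ∀ k, ∫ ω, Y k ω ^ 2 ∂P ≤ v) :
    Integrable (fun ω => ((1 / (n : ℝ)) * ∑ k, winsorize τ (Y k ω) - m) ^ 4) P ∧
      ∫ ω, ((1 / (n : ℝ)) * ∑ k, winsorize τ (Y k ω) - m) ^ 4 ∂P ≤
        8 * (4 * b ^ 2 * v + 3 * v ^ 2 + (v / a) ^ 4) / n ^ 2 := by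
  have hn0 : (0 : ℝ) < n := by exact_mod_cast hn
  have hsq : Real.sqrt n ^ 2 = n := Real.sq_sqrt hn0.le
  have hsqpos : 0 < Real.sqrt n := Real.sqrt_pos.2 hn0
  have hτ : 0 < τ := (mul_pos ha hsqpos).trans_le hτa
  have hv : 0 ≤ v := (integral_nonneg fun ω => sq_nonneg _).trans (h2 ⟨0, hn⟩)
  have hLp : ∀ k, MemLp (Y k) 2 P := fun k =>
    (memLp_two_iff_integrable_sq (hm k).aestronglyMeasurable).2 (hi2 k)
  have hiY : ∀ k, Integrable (Y k) P := fun k => (hLp k).integrable (by norm_num)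
  set ψ : Fin n → Ω → ℝ := fun k ω => winsorize τ (Y k ω) with hψ
  have hψm : ∀ k, AEMeasurable (ψ k) P := fun k => (measurable_winsorize hτ.le).comp_aemeasurable (hm k)
  have hψB : ∀ k ω, |ψ k ω| ≤ τ := fun k ω => abs_winsorize_le hτ.le _
  have hψi : ∀ k, Integrable (ψ k) P := fun k => integrable_of_abs_le (hψm k) (hψB k)
  have hψi2 : ∀ k, Integrable (fun ω => ψ k ω ^ 2) P := fun k => by
    simpa using integrable_pow_mul_pow (hψm k) (hψm k) (hψB k) (hψB k) 2 0
  set c : Fin n → ℝ := fun k => ∫ ω, ψ k ω ∂P with hc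
  have hcB : ∀ k, |c k| ≤ τ := fun k => by
    have := norm_integral_le_of_norm_le_const (μ := P) (f := ψ k)
      (Filter.Eventually.of_forall (hψB k))
    simpa using this
  have hbias : ∀ k, |c k - m| ≤ v / τ := fun k => by
    rw [hc, ← h1 k]
    simp only
    rw [← integral_sub (hψi k) (hiY k)]
    refine abs_integral_le_integral_abs.trans ?_
    refine (integral_mono ((hψi k).sub (hiY k)).abs ((hi2 k).div_const τ)
      fun ω => abs_winsorize_sub_le hτ _).trans ?_
    rw [integral_div]
    exact div_le_div_of_nonneg_right (h2 k) hτ.le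
  set Z : Fin n → Ω → ℝ := fun k ω => ψ k ω - c k with hZ
  have hZind : iIndepFun Z P :=
    hY.comp (fun k y => winsorize τ y - c k) fun k => (measurable_winsorize hτ.le).sub_const _
  have hZm : ∀ k, AEMeasurable (Z k) P := fun k => (hψm k).sub_const _
  have hZB : ∀ k ω, |Z k ω| ≤ 2 * τ := fun k ω =>
    (abs_sub _ _).trans (by linarith [hψB k ω, hcB k])
  have hZ1 : ∀ k, ∫ ω, Z k ω ∂P = 0 := fun k => by
    rw [hZ]
    simp only
    rw [integral_sub (hψi k) (integrable_const _)]
    simp [hc]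
  have hZi : ∀ k l, Integrable (fun ω => Z k ω ^ l) P := fun k l => by
    simpa using integrable_pow_mul_pow (hZm k) (hZm k) (hZB k) (hZB k) l 0
  have hZ2 : ∀ k, ∫ ω, Z k ω ^ 2 ∂P ≤ v := fun k => by
    have e : ∀ ω, Z k ω ^ 2 = ψ k ω ^ 2 + -(2 * c k) * ψ k ω + c k ^ 2 := fun ω => by
      simp only [hZ]; ring
    simp only [e]
    rw [integral_add ((hψi2 k).fun_add ((hψi k).const_mul _)) (integrable_const _),
      integral_add (hψi2 k) ((hψi k).const_mul _), integral_const_mul, integral_const,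
      probReal_univ, one_smul]
    have : ∫ ω, ψ k ω ^ 2 ∂P ≤ v :=
      (integral_mono (hψi2 k) (hi2 k) fun ω => winsorize_sq_le hτ.le _).trans (h2 k)
    change (∫ ω, ψ k ω ^ 2 ∂P) + -(2 * c k) * c k + c k ^ 2 ≤ v
    nlinarith [sq_nonneg (c k)]
  have hτ2 : τ ^ 2 ≤ b ^ 2 * n := by
    rw [← hsq, ← mul_pow]
    exact pow_le_pow_left₀ hτ.le hτb 2
  -- The upper bound on `τ` enters here: `n` fourth moments of size `O(n)` sum to `O(n²)`, the order
  -- of the Gaussian-type term `3n²v²`.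
  have hZ4 : ∀ k, ∫ ω, Z k ω ^ 4 ∂P ≤ 4 * b ^ 2 * n * v := fun k => by
    have hle : ∀ ω, Z k ω ^ 4 ≤ 4 * b ^ 2 * n * Z k ω ^ 2 := fun ω => by
      have : Z k ω ^ 2 ≤ (2 * τ) ^ 2 := by
        rw [← sq_abs]; exact pow_le_pow_left₀ (abs_nonneg _) (hZB k ω) 2
      nlinarith [sq_nonneg (Z k ω)]
    refine (integral_mono (hZi k 4) ((hZi k 2).const_mul _) hle).trans ?_
    rw [integral_const_mul]
    exact mul_le_mul_of_nonneg_left (hZ2 k) (by positivity)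
  have hS4 := (integral_sum_pow_le hZind hZm hZB hZ1 hZ2 hZ4 Finset.univ).2
  rw [Finset.card_univ, Fintype.card_fin] at hS4
  have hSm : AEMeasurable (fun ω => ∑ k, Z k ω) P := Finset.aemeasurable_fun_sum _ fun k _ => hZm k
  have hSB : ∀ ω, |∑ k, Z k ω| ≤ n * (2 * τ) := fun ω =>
    (Finset.abs_sum_le_sum_abs _ _).trans
      ((Finset.sum_le_card_nsmul Finset.univ _ _ fun k _ => hZB k ω).trans_eq (by simp))
  have hSi : Integrable (fun ω => (∑ k, Z k ω) ^ 4) P := by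
    simpa using integrable_pow_mul_pow hSm hSm hSB hSB 4 0
  set d : ℝ := (1 / (n : ℝ)) * ∑ k, (c k - m) with hd
  have hdB : |d| ≤ v / τ := by
    rw [hd, abs_mul, abs_of_nonneg (by positivity), one_div, inv_mul_le_iff₀ hn0]
    exact (Finset.abs_sum_le_sum_abs _ _).trans
      ((Finset.sum_le_card_nsmul Finset.univ _ _ fun k _ => hbias k).trans_eq (by simp))
  -- The lower bound on `τ` enters here: the bias is at most `v / τ`, of order `1/√n`.
  have hd4 : d ^ 4 ≤ (v / a) ^ 4 / n ^ 2 := by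
    have hb : |d| ≤ v / a / Real.sqrt n := by
      rw [div_div]
      exact hdB.trans (div_le_div_of_nonneg_left hv (by positivity) hτa)
    have := pow_le_pow_left₀ (abs_nonneg _) hb 4
    rwa [div_pow _ (Real.sqrt n), show Real.sqrt n ^ 4 = (n : ℝ) ^ 2 by nlinarith [hsq],
      show |d| ^ 4 = d ^ 4 from Even.pow_abs (by decide) d] at this
  have hdec : ∀ ω, (1 / (n : ℝ)) * ∑ k, winsorize τ (Y k ω) - m
      = (1 / (n : ℝ)) * (∑ k, Z k ω) + d := fun ω => by
    simp only [hd, hZ, hψ, Finset.sum_sub_distrib, Finset.sum_const, Finset.card_univ,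
      Fintype.card_fin, nsmul_eq_mul]
    field_simp
    ring
  have hTm : AEMeasurable (fun ω => (1 / (n : ℝ)) * (∑ k, Z k ω) + d) P :=
    (hSm.const_mul _).add_const _
  have hle : ∀ ω, ((1 / (n : ℝ)) * (∑ k, Z k ω) + d) ^ 4
      ≤ 8 / n ^ 4 * (∑ k, Z k ω) ^ 4 + 8 * d ^ 4 := fun ω => by
    have key : ∀ x y : ℝ, (x + y) ^ 4 ≤ 8 * x ^ 4 + 8 * y ^ 4 := fun x y => by
      nlinarith [sq_nonneg (x ^ 2 - y ^ 2), sq_nonneg (x - y), sq_nonneg ((x - y) ^ 2),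
        sq_nonneg (x ^ 2 - x * y), sq_nonneg (y ^ 2 - x * y)]
    refine (key _ _).trans_eq ?_
    rw [mul_pow]
    ring
  have hmaj : Integrable (fun ω => 8 / (n : ℝ) ^ 4 * (∑ k, Z k ω) ^ 4 + 8 * d ^ 4) P :=
    (hSi.const_mul _).add (integrable_const _)
  simp only [hdec]
  have hTi : Integrable (fun ω => ((1 / (n : ℝ)) * (∑ k, Z k ω) + d) ^ 4) P := by
    refine hmaj.mono' (hTm.pow_const 4).aestronglyMeasurable (Filter.Eventually.of_forall fun ω => ?_)
    rw [Real.norm_of_nonneg (by positivity)]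
    exact hle ω
  refine ⟨hTi, (integral_mono hTi hmaj hle).trans ?_⟩
  rw [integral_add (hSi.const_mul _) (integrable_const _), integral_const_mul, integral_const,
    probReal_univ, one_smul]
  calc 8 / (n : ℝ) ^ 4 * (∫ ω, (∑ k, Z k ω) ^ 4 ∂P) + 8 * d ^ 4
      ≤ 8 / (n : ℝ) ^ 4 * (n * (4 * b ^ 2 * n * v) + 3 * n ^ 2 * v ^ 2)
        + 8 * ((v / a) ^ 4 / n ^ 2) := by gcongr
    _ = 8 * (4 * b ^ 2 * v + 3 * v ^ 2 + (v / a) ^ 4) / n ^ 2 := by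
        field_simp

end Moments

/-! ### From errors of means to matrix norms. -/

section ErrorMatrix

variable {p : ℕ}

/-- Squared entries of the error of a covariance estimator, in terms of fourth powers of the errors
`W` of the second moments and `Z` of the means. -/
lemma cov_error_apply_sq_le {v t W z z' m m' : ℝ} (ht : 0 < t) (hm : m ^ 2 ≤ v)
    (hm' : m' ^ 2 ≤ v) :
    (W - z * z' - m * z' - m' * z) ^ 2 ≤
      4 * ((1 + 2 * v) * t + W ^ 4 / t + (1 / 2 + v / t) * (z ^ 4 + z' ^ 4)) := by
  have hv : 0 ≤ v := (sq_nonneg m).trans hm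
  -- A square is traded for a fourth power, with `t` left free: `1/n` will suit the Frobenius norm
  -- and `p/n` the max norm.
  have amgm : ∀ x : ℝ, x ^ 2 ≤ t + x ^ 4 / t := fun x => by
    rw [← sub_le_iff_le_add', le_div_iff₀ ht]
    nlinarith [sq_nonneg (x ^ 2 - t), mul_pos ht ht]
  have h4 : ∀ x y w u : ℝ, (x - y - w - u) ^ 2 ≤ 4 * (x ^ 2 + y ^ 2 + w ^ 2 + u ^ 2) :=
    fun x y w u => by
      nlinarith [sq_nonneg (x + y), sq_nonneg (x + w), sq_nonneg (x + u), sq_nonneg (y - w),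
        sq_nonneg (y - u), sq_nonneg (w - u)]
  have h1 : (z * z') ^ 2 ≤ 1 / 2 * (z ^ 4 + z' ^ 4) := by nlinarith [sq_nonneg (z ^ 2 - z' ^ 2)]
  have h2 : (m * z') ^ 2 ≤ v * (t + z' ^ 4 / t) := by
    rw [mul_pow]; exact mul_le_mul hm (amgm z') (sq_nonneg _) hv
  have h3 : (m' * z) ^ 2 ≤ v * (t + z ^ 4 / t) := by
    rw [mul_pow]; exact mul_le_mul hm' (amgm z) (sq_nonneg _) hv
  have e : (1 + 2 * v) * t + W ^ 4 / t + (1 / 2 + v / t) * (z ^ 4 + z' ^ 4)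
      = (t + W ^ 4 / t) + 1 / 2 * (z ^ 4 + z' ^ 4) + v * (t + z' ^ 4 / t)
        + v * (t + z ^ 4 / t) := by ring
  rw [e]
  linarith [h4 W (z * z') (m * z') (m' * z), amgm W]

/-- Summing the entrywise bound with `t = 1/n` over all `p²` entries costs `p²/n` in the
deterministic term. -/
lemma frobSq_cov_error_le {n : ℕ} (hn : 1 ≤ n) {v G H : ℝ} (hv : 0 ≤ v) {m z : Fin p → ℝ}
    {W E : Matrix (Fin p) (Fin p) ℝ} (hm : ∀ i, m i ^ 2 ≤ v)
    (hE : ∀ i j, E i j = W i j - z i * z j - m i * z j - m j * z i)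
    (hG : ∑ i, ∑ j, W i j ^ 4 = G) (hH : ∑ i, z i ^ 4 = H) (hG0 : 0 ≤ G) (hH0 : 0 ≤ H) :
    frobSq E ≤ 4 * (1 + 2 * v) * ((p : ℝ) ^ 2 / n + (n * G + p * n * H)) := by
  have hn' : (1 : ℝ) ≤ n := by exact_mod_cast hn
  have hn0 : (0 : ℝ) < n := by linarith
  have hp0 : (0 : ℝ) ≤ p := Nat.cast_nonneg p
  have h1 : frobSq E ≤ ∑ i, ∑ j, 4 * ((1 + 2 * v) * (1 / (n : ℝ)) + W i j ^ 4 / (1 / (n : ℝ))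
      + (1 / 2 + v / (1 / (n : ℝ))) * (z i ^ 4 + z j ^ 4)) :=
    Finset.sum_le_sum fun i _ => Finset.sum_le_sum fun j _ => by
      rw [hE]; exact cov_error_apply_sq_le (by positivity) (hm i) (hm j)
  refine h1.trans ?_
  simp only [← Finset.mul_sum, Finset.sum_add_distrib, ← Finset.sum_div, Finset.sum_const,
    Finset.card_univ, Fintype.card_fin, nsmul_eq_mul]
  rw [hG, hH]
  have e : 4 * ((1 + 2 * v) * ((p : ℝ) * ((p : ℝ) * 1) / (n : ℝ)) + G / (1 / (n : ℝ))
      + (1 / 2 + v / (1 / (n : ℝ))) * (p * H + p * H))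
      = 4 * ((1 + 2 * v) * ((p : ℝ) ^ 2 / n) + n * G + (1 + 2 * v * n) * (p * H)) := by
    field_simp
    ring
  have h2 : n * G ≤ (1 + 2 * v) * (n * G) :=
    le_mul_of_one_le_left (mul_nonneg hn0.le hG0) (by linarith)
  have h3 : (1 + 2 * v * n) * (p * H) ≤ ((1 + 2 * v) * n) * (p * H) :=
    mul_le_mul_of_nonneg_right (by linarith) (mul_nonneg hp0 hH0)
  rw [e]
  linarith

/-- The larger choice `t = p/n` is affordable because one maximum is taken instead of `p²` summands.
A maximum of fourth powers is at most `G` or `H`, and multiplying by `s ≤ p` restores the scale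
`p²/n`. -/
lemma sparse_mul_maxNorm_cov_error_le {n s : ℕ} (hn : 1 ≤ n) (hp : 1 ≤ p) (hs : s ≤ p)
    {v G H : ℝ} {m z : Fin p → ℝ} {W E : Matrix (Fin p) (Fin p) ℝ} (hm : ∀ i, m i ^ 2 ≤ v)
    (hE : ∀ i j, E i j = W i j - z i * z j - m i * z j - m j * z i)
    (hG : ∀ i j, W i j ^ 4 ≤ G) (hH : ∀ i, z i ^ 4 ≤ H) (hG0 : 0 ≤ G) (hH0 : 0 ≤ H) :
    s * maxNorm E ^ 2 ≤ 4 * (1 + 2 * v) * ((p : ℝ) ^ 2 / n + (n * G + p * n * H)) := by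
  have hn' : (1 : ℝ) ≤ n := by exact_mod_cast hn
  have hp' : (1 : ℝ) ≤ p := by exact_mod_cast hp
  have hs' : (s : ℝ) ≤ p := by exact_mod_cast hs
  have hn0 : (0 : ℝ) < n := by linarith
  have hp0 : (0 : ℝ) < p := by linarith
  have hv : 0 ≤ v := (sq_nonneg _).trans (hm ⟨0, hp⟩)
  have hb : 4 * ((1 + 2 * v) * ((p : ℝ) / n) + G / ((p : ℝ) / n)
      + (1 / 2 + v / ((p : ℝ) / n)) * (H + H)) * p
      ≤ 4 * (1 + 2 * v) * ((p : ℝ) ^ 2 / n + (n * G + p * n * H)) := by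
    have e : 4 * ((1 + 2 * v) * ((p : ℝ) / n) + G / ((p : ℝ) / n)
        + (1 / 2 + v / ((p : ℝ) / n)) * (H + H)) * p
        = 4 * ((1 + 2 * v) * ((p : ℝ) ^ 2 / n) + n * G + (p + 2 * v * n) * H) := by
      field_simp
      ring
    have h3 : n * G ≤ (1 + 2 * v) * (n * G) :=
      le_mul_of_one_le_left (mul_nonneg hn0.le hG0) (by linarith)
    have h5 : (p : ℝ) ≤ p * n := le_mul_of_one_le_right hp0.le hn'
    have h6 : v * n ≤ v * (p * n) :=
      mul_le_mul_of_nonneg_left (le_mul_of_one_le_left hn0.le hp') hv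
    have h4 : (p + 2 * v * n) * H ≤ (p * n + 2 * (v * (p * n))) * H :=
      mul_le_mul_of_nonneg_right (by linarith) hH0
    rw [e]
    linarith
  set B := 4 * ((1 + 2 * v) * ((p : ℝ) / n) + G / ((p : ℝ) / n)
      + (1 / 2 + v / ((p : ℝ) / n)) * (H + H)) with hB
  have hB0 : 0 ≤ B := by positivity
  have h1 : ∀ i j, E i j ^ 2 ≤ B := fun i j => by
    rw [hE]
    refine (cov_error_apply_sq_le (t := (p : ℝ) / n) (by positivity) (hm i) (hm j)).trans ?_
    rw [hB]
    gcongr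
    exacts [hG i j, hH i, hH j]
  have h2 : maxNorm E ≤ Real.sqrt B :=
    maxNorm_le (Real.sqrt_nonneg _) fun i j => Real.abs_le_sqrt (h1 i j)
  have h3 : maxNorm E ^ 2 ≤ B := by
    rw [← Real.sq_sqrt hB0]
    exact pow_le_pow_left₀ (maxNorm_nonneg E) h2 2
  calc s * maxNorm E ^ 2 ≤ p * B := mul_le_mul hs' h3 (sq_nonneg _) hp0.le
    _ = B * p := mul_comm _ _
    _ ≤ _ := hb

lemma rank_spec_add_sparse_max_le {n r s : ℕ} (hn : 1 ≤ n) (hp : 1 ≤ p) (hr : 1 ≤ r) (hs : s ≤ p)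
    {v : ℝ} {m z : Fin p → ℝ} {W E : Matrix (Fin p) (Fin p) ℝ} (hm : ∀ i, m i ^ 2 ≤ v)
    (hE : ∀ i j, E i j = W i j - z i * z j - m i * z j - m j * z i) :
    r * specNorm E ^ 2 + s * maxNorm E ^ 2 ≤ 8 * (1 + 2 * v) * r *
      ((p : ℝ) ^ 2 / n + (n * ∑ i, ∑ j, W i j ^ 4 + p * n * ∑ i, z i ^ 4)) := by
  have hr' : (1 : ℝ) ≤ r := by exact_mod_cast hr
  have hv : 0 ≤ v := (sq_nonneg _).trans (hm ⟨0, hp⟩)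
  have hG0 : 0 ≤ ∑ i, ∑ j, W i j ^ 4 := by positivity
  have hH0 : 0 ≤ ∑ i, z i ^ 4 := by positivity
  have hWG : ∀ i j, W i j ^ 4 ≤ ∑ i, ∑ j, W i j ^ 4 := fun i j =>
    (Finset.single_le_sum (f := fun j => W i j ^ 4) (fun _ _ => by positivity)
      (Finset.mem_univ j)).trans
      (Finset.single_le_sum (f := fun i => ∑ j, W i j ^ 4) (fun _ _ => by positivity)
        (Finset.mem_univ i))
  have hzH : ∀ i, z i ^ 4 ≤ ∑ i, z i ^ 4 := fun i =>
    Finset.single_le_sum (f := fun i => z i ^ 4) (fun _ _ => by positivity) (Finset.mem_univ i)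
  have hfrob := frobSq_cov_error_le hn hv hm hE rfl rfl hG0 hH0
  have hmax := sparse_mul_maxNorm_cov_error_le hn hp hs hm hE hWG hzH hG0 hH0
  have hspec := mul_le_mul_of_nonneg_left ((specNorm_sq_le E).trans hfrob) (by linarith : 0 ≤ (r : ℝ))
  have := le_mul_of_one_le_left ((frobSq_nonneg E).trans hfrob) hr'
  linarith

end ErrorMatrix

/-! ### Markov's inequality for the pilot estimator. -/

section Tail

/-- Constant in the fourth-moment bound of the Winsorized means. -/
noncomputable def momentConst (C a b : ℝ) : ℝ :=
  8 * (4 * b ^ 2 * (C + 1) + 3 * (C + 1) ^ 2 + ((C + 1) / a) ^ 4)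

lemma momentConst_pos {C a b : ℝ} (hC : 0 < C) : 0 < momentConst C a b := by
  unfold momentConst; positivity

/-- Tail bound for the error of the Winsorized covariance estimator. -/
theorem pilotCov_tail_le {C a b ε : ℝ} (hC : 0 < C) (ha : 0 < a) (hε : 0 < ε)
    {n p r s : ℕ} {τ₁ τ₂ : ℝ} (hn : 1 ≤ n) (hp : 2 ≤ p) (hr : 1 ≤ r) (hs : s ≤ p)
    (h1a : a * Real.sqrt n ≤ τ₁) (h1b : τ₁ ≤ b * Real.sqrt n)
    (h2a : a * Real.sqrt n ≤ τ₂) (h2b : τ₂ ≤ b * Real.sqrt n)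
    {Ω : Type*} [MeasurableSpace Ω] {P : Measure Ω} [IsProbabilityMeasure P]
    {X : Fin n → Ω → Fin p → ℝ} (hX : iIndepFun X P)
    (hid : ∀ k l, IdentDistrib (X k) (X l) P P)
    (h4 : ∀ k j, Integrable (fun ω => X k ω j ^ 4) P ∧ ∫ ω, X k ω j ^ 4 ∂P ≤ C)
    {Sig : Matrix (Fin p) (Fin p) ℝ} (hcov : ∀ k, covMatrix P (X k) = Sig) :
    P {ω | 8 * (1 + 2 * (C + 1)) * (1 + 2 * momentConst C a b / ε) / Real.log 2 ^ 2 *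
          (r * (p : ℝ) ^ 2 * Real.log p ^ 2 / n) <
        r * specNorm (pilotCov τ₁ τ₂ (fun k => X k ω) - Sig) ^ 2 +
          s * maxNorm (pilotCov τ₁ τ₂ (fun k => X k ω) - Sig) ^ 2} ≤ ENNReal.ofReal ε := by
  have hn0 : (0 : ℝ) < n := by exact_mod_cast hn
  have hp0 : (0 : ℝ) < p := by exact_mod_cast (by omega : 0 < p)
  have hr0 : (0 : ℝ) < r := by exact_mod_cast hr
  have hC1 := momentConst_pos (a := a) (b := b) hC
  have hXm : ∀ k, AEMeasurable (X k) P := fun k => (hid k k).aemeasurable_fst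
  have hXim : ∀ k i, AEMeasurable (fun ω => X k ω i) P := fun k i =>
    (measurable_pi_apply i).comp_aemeasurable (hXm k)
  have hprod_meas : ∀ i j, Measurable fun x : Fin p → ℝ => x i * x j := fun i j => by fun_prop
  -- The value `C + 1` comes from `x² ≤ x⁴ + 1`; it serves as a common second-moment bound for
  -- coordinates and products.
  have hsq : ∀ k i, Integrable (fun ω => X k ω i ^ 2) P ∧ ∫ ω, X k ω i ^ 2 ∂P ≤ C + 1 :=
    fun k i => by
    have hle : ∀ ω, X k ω i ^ 2 ≤ X k ω i ^ 4 + 1 := fun ω => by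
      nlinarith [sq_nonneg (X k ω i ^ 2 - 1), sq_nonneg (X k ω i ^ 2)]
    have hmaj : Integrable (fun ω => X k ω i ^ 4 + 1) P := (h4 k i).1.add (integrable_const _)
    have hint : Integrable (fun ω => X k ω i ^ 2) P :=
      hmaj.mono' ((hXim k i).pow_const 2).aestronglyMeasurable
        (Filter.Eventually.of_forall fun ω => by
          rw [Real.norm_of_nonneg (sq_nonneg _)]; exact hle ω)
    refine ⟨hint, (integral_mono hint hmaj hle).trans ?_⟩
    rw [integral_add (h4 k i).1 (integrable_const _)]
    simpa using (h4 k i).2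
  have hsqp : ∀ k i j, Integrable (fun ω => (X k ω i * X k ω j) ^ 2) P ∧
      ∫ ω, (X k ω i * X k ω j) ^ 2 ∂P ≤ C + 1 := fun k i j => by
    have hle : ∀ ω, (X k ω i * X k ω j) ^ 2 ≤ 1 / 2 * X k ω i ^ 4 + 1 / 2 * X k ω j ^ 4 :=
      fun ω => by nlinarith [sq_nonneg (X k ω i ^ 2 - X k ω j ^ 2)]
    have hmaj : Integrable (fun ω => 1 / 2 * X k ω i ^ 4 + 1 / 2 * X k ω j ^ 4) P :=
      ((h4 k i).1.const_mul _).add ((h4 k j).1.const_mul _)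
    have hint : Integrable (fun ω => (X k ω i * X k ω j) ^ 2) P :=
      hmaj.mono' (((hXim k i).mul (hXim k j)).pow_const 2).aestronglyMeasurable
        (Filter.Eventually.of_forall fun ω => by
          rw [Real.norm_of_nonneg (sq_nonneg _)]; exact hle ω)
    refine ⟨hint, (integral_mono hint hmaj hle).trans ?_⟩
    rw [integral_add ((h4 k i).1.const_mul _) ((h4 k j).1.const_mul _), integral_const_mul,
      integral_const_mul]
    linarith [(h4 k i).2, (h4 k j).2]
  have hLp : ∀ k i, MemLp (fun ω => X k ω i) 2 P := fun k i =>
    (memLp_two_iff_integrable_sq (hXim k i).aestronglyMeasurable).2 (hsq k i).1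
  set k₀ : Fin n := ⟨0, hn⟩
  set m : Fin p → ℝ := fun i => ∫ ω, X k₀ ω i ∂P with hm
  have hmean : ∀ k i, ∫ ω, X k ω i ∂P = m i := fun k i =>
    ((hid k k₀).comp (measurable_pi_apply i)).integral_eq
  have hmsq : ∀ i, m i ^ 2 ≤ C + 1 := fun i =>
    (sq_integral_le_integral_sq (hLp k₀ i)).trans (hsq k₀ i).2
  have hsecond : ∀ k i j, ∫ ω, X k ω i * X k ω j ∂P = Sig i j + m i * m j := fun k i j => by
    have h := covariance_eq_sub (hLp k i) (hLp k j)
    have h' : Sig i j = covariance (fun ω => X k ω i) (fun ω => X k ω j) P := by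
      rw [← hcov k]; rfl
    rw [h', h, hmean, hmean]
    simp
  -- `W` is centered at the raw second moments `Sig + m mᵀ`, so the error of the estimator becomes a
  -- polynomial in `W`, `z` and `m`.
  set W : Ω → Matrix (Fin p) (Fin p) ℝ := fun ω => Matrix.of fun i j =>
    (1 / (n : ℝ)) * ∑ k, winsorize τ₁ (X k ω i * X k ω j) - (Sig i j + m i * m j) with hW
  set z : Ω → Fin p → ℝ := fun ω i => (1 / (n : ℝ)) * ∑ k, winsorize τ₂ (X k ω i) - m i with hz
  have hWint : ∀ i j, Integrable (fun ω => W ω i j ^ 4) P ∧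
      ∫ ω, W ω i j ^ 4 ∂P ≤ momentConst C a b / n ^ 2 := fun i j =>
    integral_winsorized_mean_sub_pow_four_le hn ha h1a h1b
      (hX.comp (fun _ x => x i * x j) fun _ => hprod_meas i j)
      (fun k => (hXim k i).mul (hXim k j)) (fun k => hsecond k i j) (fun k => (hsqp k i j).1)
      fun k => (hsqp k i j).2
  have hzint : ∀ i, Integrable (fun ω => z ω i ^ 4) P ∧
      ∫ ω, z ω i ^ 4 ∂P ≤ momentConst C a b / n ^ 2 := fun i =>
    integral_winsorized_mean_sub_pow_four_le hn ha h2a h2b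
      (hX.comp (fun _ x => x i) fun _ => measurable_pi_apply i)
      (fun k => hXim k i) (fun k => hmean k i) (fun k => (hsq k i).1) fun k => (hsq k i).2
  set T : Ω → ℝ := fun ω => n * ∑ i, ∑ j, W ω i j ^ 4 + p * n * ∑ i, z ω i ^ 4 with hT
  have hWi : Integrable (fun ω => ∑ i, ∑ j, W ω i j ^ 4) P :=
    integrable_finsetSum _ fun i _ => integrable_finsetSum _ fun j _ => (hWint i j).1
  have hzi : Integrable (fun ω => ∑ i, z ω i ^ 4) P :=
    integrable_finsetSum _ fun i _ => (hzint i).1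
  have hTi : Integrable T P := (hWi.const_mul _).add (hzi.const_mul _)
  have hTE : ∫ ω, T ω ∂P ≤ 2 * momentConst C a b * ((p : ℝ) ^ 2 / n) := by
    rw [hT, integral_add (hWi.const_mul _) (hzi.const_mul _), integral_const_mul,
      integral_const_mul, integral_finsetSum _ fun i _ => (hzint i).1,
      integral_finsetSum _ fun i _ => integrable_finsetSum _ fun j _ => (hWint i j).1]
    have hA : ∑ i, ∫ ω, ∑ j, W ω i j ^ 4 ∂P ≤ p * (p * (momentConst C a b / n ^ 2)) := by
      refine (Finset.sum_le_card_nsmul _ _ (p * (momentConst C a b / n ^ 2)) fun i _ => ?_).trans_eq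
        (by simp)
      rw [integral_finsetSum _ fun j _ => (hWint i j).1]
      exact (Finset.sum_le_card_nsmul _ _ _ fun j _ => (hWint i j).2).trans_eq (by simp)
    have hB : ∑ i, ∫ ω, z ω i ^ 4 ∂P ≤ p * (momentConst C a b / n ^ 2) :=
      (Finset.sum_le_card_nsmul _ _ _ fun i _ => (hzint i).2).trans_eq (by simp)
    calc _ ≤ n * (p * (p * (momentConst C a b / n ^ 2)))
          + p * n * (p * (momentConst C a b / n ^ 2)) := by gcongr
      _ = 2 * momentConst C a b * ((p : ℝ) ^ 2 / n) := by field_simp; ring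
  -- The bound on the expectation of `T`, divided by `ε`.
  set t : ℝ := 2 * momentConst C a b / ε * ((p : ℝ) ^ 2 / n) with ht
  have ht0 : 0 < t := by positivity
  have hmarkov : P.real {ω | t ≤ T ω} ≤ ε := by
    have h := mul_meas_ge_le_integral_of_nonneg (μ := P)
      (Filter.Eventually.of_forall fun ω => by positivity : 0 ≤ᵐ[P] T) hTi t
    have h2 : t * P.real {ω | t ≤ T ω} ≤ t * ε := by
      refine (h.trans hTE).trans_eq ?_
      rw [ht]; field_simp
    exact le_of_mul_le_mul_left h2 ht0
  refine (measure_mono fun ω hω => ?_).trans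
    ((ENNReal.le_ofReal_iff_toReal_le (measure_ne_top P _) hε.le).2 hmarkov)
  by_contra hlt
  have hlt' : T ω < t := not_le.1 hlt
  rw [Set.mem_ofPred_eq] at hω
  refine absurd hω (not_lt.2 ?_)
  have hbound := rank_spec_add_sparse_max_le (v := C + 1) (m := m) (z := z ω) (W := W ω)
    (E := pilotCov τ₁ τ₂ (fun k => X k ω) - Sig) hn (by omega) hr hs hmsq fun i j => by
      simp only [hW, hz, pilotCov, Matrix.sub_apply, Matrix.of_apply]
      ring
  refine hbound.trans ?_
  have hlog2 : 0 < Real.log 2 := Real.log_pos (by norm_num)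
  have hlog : Real.log 2 ^ 2 ≤ Real.log p ^ 2 :=
    pow_le_pow_left₀ hlog2.le (Real.log_le_log (by norm_num) (by exact_mod_cast hp)) 2
  -- As `p ≥ 2`, the logarithmic factor can be inserted at the price of the constant `1 / log² 2`.
  have hratio : 1 ≤ Real.log p ^ 2 / Real.log 2 ^ 2 := (one_le_div (by positivity)).2 hlog
  calc 8 * (1 + 2 * (C + 1)) * r * ((p : ℝ) ^ 2 / n + T ω)
      ≤ 8 * (1 + 2 * (C + 1)) * r * ((p : ℝ) ^ 2 / n + t) := by gcongr
    _ = 8 * (1 + 2 * (C + 1)) * (1 + 2 * momentConst C a b / ε) * (r * (p : ℝ) ^ 2 / n) := by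
        rw [ht]; ring
    _ ≤ 8 * (1 + 2 * (C + 1)) * (1 + 2 * momentConst C a b / ε) * (r * (p : ℝ) ^ 2 / n) *
          (Real.log p ^ 2 / Real.log 2 ^ 2) := le_mul_of_one_le_right (by positivity) hratio
    _ = _ := by ring

end Tail

end RobustCov

/-! ### The two statements combined. -/

theorem mainTheorem9 :
    ∃ c : ℝ, 0 < c ∧
    ∀ A : ℝ, 1 ≤ A → ∃ K : ℝ, 0 < K ∧
    ∀ C a b : ℝ, 0 < C → 0 < a → a ≤ b →
    ∀ ε : ℝ, 0 < ε → ∃ M : ℝ, 0 < M ∧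
    ∀ (n p r rbar s sbar : ℕ) (μ μbar τ₁ τ₂ : ℝ),
      1 ≤ n → 2 ≤ p → 1 ≤ r →
      -- the known upper bounds of rank, sparsity and incoherence, of the right order
      r ≤ rbar → s ≤ sbar → μ ≤ μbar →
      (rbar : ℝ) ≤ A * r → (sbar : ℝ) ≤ A * s →
      (sbar : ℝ) ≤ p / (8 * c * μbar * (rbar : ℝ) ^ 4) →
      -- truncation levels of order √n
      a * Real.sqrt n ≤ τ₁ → τ₁ ≤ b * Real.sqrt n →
      a * Real.sqrt n ≤ τ₂ → τ₂ ≤ b * Real.sqrt n →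
    ∀ (SigmaL SigmaS : Matrix (Fin p) (Fin p) ℝ),
      RobustCov.HasIncoherentSVD r μ SigmaL →
      RobustCov.HasIncoherentSVD rbar μbar SigmaL →
      RobustCov.numNonzero SigmaS ≤ s →
    ∀ (Ω : Type*) [MeasurableSpace Ω] (P : Measure Ω) [IsProbabilityMeasure P]
      (X : Fin n → Ω → Fin p → ℝ),
      iIndepFun X P →
      (∀ k l, IdentDistrib (X k) (X l) P P) →
      (∀ k j, Integrable (fun ω => X k ω j ^ 4) P ∧ ∫ ω, X k ω j ^ 4 ∂P ≤ C) →
      (∀ k, RobustCov.covMatrix P (X k) = SigmaL + SigmaS) →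
    ∀ (hatL hatS : Ω → Matrix (Fin p) (Fin p) ℝ),
      (∀ ω, RobustCov.IsConstrainedLS rbar sbar μbar
        (RobustCov.pilotCov τ₁ τ₂ fun k => X k ω) (hatL ω) (hatS ω)) →
      (∀ ω, RobustCov.frobNorm (hatL ω - SigmaL) ^ 2 + RobustCov.frobNorm (hatS ω - SigmaS) ^ 2 ≤
        K * (r * RobustCov.specNorm
              (RobustCov.pilotCov τ₁ τ₂ (fun k => X k ω) - (SigmaL + SigmaS)) ^ 2 +
            s * RobustCov.maxNorm
              (RobustCov.pilotCov τ₁ τ₂ (fun k => X k ω) - (SigmaL + SigmaS)) ^ 2)) ∧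
      P {ω | M * (r * (p : ℝ) ^ 2 * Real.log p ^ 2 / n) <
          r * RobustCov.specNorm
              (RobustCov.pilotCov τ₁ τ₂ (fun k => X k ω) - (SigmaL + SigmaS)) ^ 2 +
            s * RobustCov.maxNorm
              (RobustCov.pilotCov τ₁ τ₂ (fun k => X k ω) - (SigmaL + SigmaS)) ^ 2} ≤
        ENNReal.ofReal ε := by
  -- With `c = 4` the constant `8c` is the `32` required by `IsConstrainedLS.error_le`. The factor
  -- `A` in `64 * A` pays for replacing `rbar`, `sbar` by `r`, `s`.
  refine ⟨4, by norm_num, fun A hA => ⟨64 * A, by positivity, fun C a b hC ha _ ε hε => ?_⟩⟩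
  have hC1 := RobustCov.momentConst_pos (a := a) (b := b) hC
  have hlog2 : 0 < Real.log 2 := Real.log_pos (by norm_num)
  refine ⟨8 * (1 + 2 * (C + 1)) * (1 + 2 * RobustCov.momentConst C a b / ε) / Real.log 2 ^ 2,
    by positivity, ?_⟩
  intro n p r rbar s sbar μ μbar τ₁ τ₂ hn hp hr hrr hss _ hrA hsA hsp h1a h1b h2a h2b
    SigmaL SigmaS _ hLbar hS Ω _ P _ X hX hid h4 hcov hatL hatS hsol
  have hrb : 1 ≤ rbar := hr.trans hrr
  have hμ : 1 ≤ μbar := by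
    obtain ⟨U, -, -, hU, -⟩ := hLbar
    exact hU.one_le hrb (by omega)
  have hp0 : (0 : ℝ) < p := by exact_mod_cast (by omega : 0 < p)
  have hrb1 : (1 : ℝ) ≤ rbar := by exact_mod_cast hrb
  -- Only the first power of `rbar` is needed in the sparsity condition.
  have hr4 : (rbar : ℝ) ≤ (rbar : ℝ) ^ 4 := le_self_pow₀ hrb1 (by norm_num)
  have hden : (rbar : ℝ) * μbar ≤ μbar * (rbar : ℝ) ^ 4 := by nlinarith
  rw [le_div_iff₀ (by positivity)] at hsp
  have hsμ : (sbar : ℝ) * (32 * (rbar * μbar)) ≤ p := by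
    refine le_trans ?_ hsp
    have : (sbar : ℝ) * (32 * (rbar * μbar)) ≤ sbar * (32 * (μbar * (rbar : ℝ) ^ 4)) := by gcongr
    linarith
  refine ⟨fun ω => ?_, RobustCov.pilotCov_tail_le hC ha hε hn hp hr ?_ h1a h1b h2a h2b hX hid h4
    hcov⟩
  · rw [RobustCov.frobNorm_sq, RobustCov.frobNorm_sq]
    refine ((hsol ω).error_le ⟨hLbar, hS.trans hss⟩ (by linarith) ?_).trans ?_
    · have e : 32 * (μbar * rbar / p) * sbar = sbar * (32 * (rbar * μbar)) / p := by ring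
      rw [e]
      exact (div_le_one hp0).2 hsμ
    · calc _ ≤ 64 * (A * r * _ ^ 2 + A * s * _ ^ 2) := by gcongr
        _ = _ := by ring
  -- Since `rbar` and `μbar` are at least `1`, the sparsity condition forces `s ≤ p`.
  · have h1 : (1 : ℝ) ≤ 32 * (rbar * μbar) := by nlinarith
    have h2 : (s : ℝ) ≤ sbar := by exact_mod_cast hss
    have h3 : (sbar : ℝ) ≤ sbar * (32 * (rbar * μbar)) :=
      le_mul_of_one_le_right (Nat.cast_nonneg _) h1
    exact_mod_cast (h2.trans h3).trans hsμ
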